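/- **Theorem 2.1 (Finite-$N_c$ dressing symmetry).** *Loops.* A loop is a Lipschitz $2\pi$-periodic map $C:\mathbb R\to\mathbb R^4$. If $C(s)=C(t)$ with $s\not\equiv t \pmod{2\pi}$, let $C_{st}$ and $C_{ts}$ be the two closed pieces of $C$, from $s$ to $t$ and from $t$ to $s$, rescaled affinely to $[0,2\pi]$. If $C(s)=D(t)$, let $C\circ_{s,t}D$ be the loop that runs once around $C$ from $s$ and then once around $D$ from $t$, rescaled to $[0,2\pi]$. *Loop operator.* For a complex-valued functional $F$ of loops, $\frac{\delta F}{\delta C'_\mu(\theta)}=g_\mu(\theta)$ means that for some constants $c_\mu$ and all smooth loops $h$ $$\frac{d}{dt}\Big|_{t=0}F[C+th]=\oint g_\mu(\theta)h'_\mu(\theta)\,d\theta+c_\mu\oint h_\mu(\theta)\,d\theta ,\qquad \oint g_\mu\,d\theta=0 .$$ The first derivative $g$ is required to be continuous in $\theta$; kernels of derivatives of quantities attached to a point $b$ of the loop are required to be continuous off $b$ with one-sided limits at $b$. Set $$\frac{\delta F}{\delta\sigma_{\mu\nu}(\theta)}=\frac{\delta^2F}{\delta C'_\mu(\theta-0)\,\delta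 C'_\nu(\theta+0)}-(\mu\leftrightarrow\nu),\qquad \mathcal L F[C]=\oint d\theta\, C'_\nu(\theta)\Big(\frac{\delta}{\delta C'_\mu(\theta+0)}-\frac{\delta}{\delta C'_\mu(\theta-0)}\Big)\frac{\delta F}{\delta\sigma_{\mu\nu}(\theta)} .$$ "$\mathcal LF[C]=\ell$" includes that the derivatives exist for almost every $\theta$: the first and second derivatives and the area derivative at all loops of some set containing $C$ and stable under small multiples of each smooth variation, and the last derivative at $C$. The integrand is required to be integrable. *Hierarchy.* Let $N_c\ge1$ be an integer, $\mathcal D$ a set of loops (on which the equations are imposed), $\delta_k\ge 0$ continuous functions on $\mathbb R^4$ with $\int\delta_k=1$ and supports shrinking to $\{0\}$, and $\lambda_k\in\mathbb R$ (the bare coupling belonging to $\delta_k$; for instance constant). For loops $C,D$ and a function $f$ defined at their intersections, $\lambda\iint d\theta_1d\theta_2\,C'(\theta_1)\!\cdot\! D'(\theta_2)\,\delta(C(\theta_1)-D(\theta_2))f(\theta_1,\theta_2)$ denotes the limit of $\lambda_k\iint d\theta_1d\theta_2\, C'(\theta_1)\!\cdot\! D'(\theta_2)\,\delta_k(C(\theta_1)-D(\theta_2))\tilde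 f(\theta_1,\theta_2)$ as $k\to\infty$, provided that $f$ has a continuous extension $\tilde f$ to the torus and that the limit exists and is the same for all such $\tilde f$. In the integral of a loop with itself only the self-intersections with $\theta_1\not\equiv\theta_2$ count, and $\tilde f$ has to vanish near the diagonal. A family of functionals $W_n(C_1,\dots,C_n)\in\mathbb C$, $n\ge1$, satisfies the Makeenko–Migdal multiloop hierarchy for $\mathrm{SU}(N_c)$ on $\mathcal D$ if for all $n\ge 1$, all $C_1,\dots,C_n\in\mathcal D$ and all $i$ for which each integral on the right-hand side exists, $\mathcal L_iW_n$ ($\mathcal L$ acting on the $i$-th loop) exists and $$\begin{aligned}\mathcal L_iW_n={}&\lambda\iint d\theta_1d\theta_2\,C_i'(\theta_1)\!\cdot\! C_i'(\theta_2)\,\delta(C_i(\theta_1)-C_i(\theta_2))\Big[W_{n+1}(\dots,(C_i)_{\theta_1\theta_2},\dots,(C_i)_{\theta_2\theta_1})-\tfrac1{N_c^2}W_n\Big]\\&+\lambda\sum_{j\ne i}\iint d\theta_1d\theta_2\,C_i'(\theta_1)\!\cdot\! C_j'(\theta_2)\,\delta(C_i(\theta_1)-C_j(\theta_2))\,\tfrac1{N_c^2}\Big[W_{n-1}(\dots,C_i\circ_{\theta_1,\theta_2}C_j,\dots)-W_n\Big],\end{aligned}$$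 where in $W_{n+1}$ the first piece replaces $C_i$ and the second is appended, and in $W_{n-1}$ the joined loop replaces $C_i$ and $C_j$ is removed. *Claim.* Let $S$ be a real functional of loops such that 1. $\mathcal L S[C]=0$ for all $C\in\mathcal D$; 2. $S[C]=S[C_{st}]+S[C_{ts}]$ for every $C\in\mathcal D$ and every self-intersection $C(s)=C(t)$, $s\not\equiv t$, and $S[C\circ_{s,t}D]=S[C]+S[D]$ for all $C,D\in\mathcal D$ and every intersection $C(s)=D(t)$. If $\{W_n\}$ satisfies the multiloop hierarchy for $\mathrm{SU}(N_c)$ on $\mathcal D$, then for every $\kappa>0$ so does $$\widetilde W_n(C_1,\dots,C_n)=W_n(C_1,\dots,C_n)\,\exp\Big(-\kappa\sum_{i=1}^nS[C_i]\Big),$$ with the same $N_c$, $\lambda_k$, $\delta_k$ and $\mathcal D$. -/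

import Mathlib

open MeasureTheory Filter Topology
open scoped NNReal ContDiff

noncomputable section

namespace LoopEq

/-- Four-dimensional Euclidean space. -/
abbrev E4 : Type := EuclideanSpace ℝ (Fin 4)

/-- The length of the standard parameter interval `[0, 2π]`. -/
abbrev T : ℝ := 2 * Real.pi

lemma T_pos : 0 < T := Real.two_pi_pos

/-- A parametrized closed loop in `ℝ⁴`: a Lipschitz, `2π`-periodic map. Corners are allowed, so
the class is stable under cutting and joining at intersection points. -/
structure Loop where
  toFun : ℝ → E4
  lipschitz : ∃ K : ℝ≥0, LipschitzWith K toFun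
  periodic : Function.Periodic toFun T

namespace Loop

instance : CoeFun Loop (fun _ => ℝ → E4) := ⟨Loop.toFun⟩

/-- Pointwise sum of loops. -/
instance : Add Loop where
  add C D :=
    { toFun := fun θ => C θ + D θ
      lipschitz := by
        obtain ⟨K, hK⟩ := C.lipschitz
        obtain ⟨L, hL⟩ := D.lipschitz
        exact ⟨K + L, hK.add hL⟩
      periodic := fun θ => by simp only [C.periodic θ, D.periodic θ] }

/-- Pointwise real multiples of loops. -/
instance : SMul ℝ Loop where
  smul r C :=
    { toFun := fun θ => r • C θ
      lipschitz := by
        obtain ⟨K, hK⟩ := C.lipschitz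
        exact ⟨‖r‖₊ * K, (lipschitzWith_smul r).comp hK⟩
      periodic := fun θ => by simp only [C.periodic θ] }

end Loop

/-- Two Lipschitz pieces with a common point form a Lipschitz piece. -/
lemma lipschitz_glue {f : ℝ → E4} {K : ℝ≥0} {a b c : ℝ}
    (h1 : LipschitzOnWith K f (Set.Icc a b)) (h2 : LipschitzOnWith K f (Set.Icc b c)) :
    LipschitzOnWith K f (Set.Icc a c) := by
  refine LipschitzOnWith.of_dist_le_mul fun x hx y hy => ?_
  wlog hxy : x ≤ y generalizing x y
  · rw [dist_comm (f x), dist_comm x]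
    exact this y hy x hx (le_of_not_ge hxy)
  rcases le_total y b with hyb | hyb
  · exact h1.dist_le_mul x ⟨hx.1, hxy.trans hyb⟩ y ⟨hy.1, hyb⟩
  rcases le_total b x with hbx | hbx
  · exact h2.dist_le_mul x ⟨hbx, hx.2⟩ y ⟨hyb, hy.2⟩
  · have e1 := h1.dist_le_mul x ⟨hx.1, hbx⟩ b ⟨hx.1.trans hbx, le_refl b⟩
    have e2 := h2.dist_le_mul b ⟨le_refl b, hyb.trans hy.2⟩ y ⟨hyb, hy.2⟩
    have e3 := dist_triangle (f x) (f b) (f y)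
    rw [Real.dist_eq, abs_of_nonpos (by linarith)] at e1 e2 ⊢
    nlinarith

/-- A periodic map that is Lipschitz on one period is Lipschitz. -/
lemma lipschitz_of_periodic {f : ℝ → E4} {K : ℝ≥0} (hp : Function.Periodic f T)
    (h : LipschitzOnWith K f (Set.Icc 0 T)) : LipschitzWith K f := by
  have h2 : LipschitzOnWith K f (Set.Icc T (2 * T)) := by
    refine LipschitzOnWith.of_dist_le_mul fun x hx y hy => ?_
    have := h.dist_le_mul (x - T) ⟨by linarith [hx.1], by linarith [hx.2]⟩
      (y - T) ⟨by linarith [hy.1], by linarith [hy.2]⟩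
    rwa [hp.sub_eq, hp.sub_eq, dist_sub_right] at this
  have h3 := lipschitz_glue h h2
  refine LipschitzWith.of_dist_le_mul fun x y => ?_
  wlog hxy : x ≤ y generalizing x y
  · rw [dist_comm (f x), dist_comm x]
    exact this y x (le_of_not_ge hxy)
  have hT : (0 : ℝ) < T := T_pos
  rcases le_total (y - x) T with hd | hd
  · have hm := toIcoMod_mem_Ico hT 0 x
    rw [zero_add] at hm
    have hx : f (toIcoMod hT 0 x) = f x := by
      rw [toIcoMod]; exact hp.sub_zsmul_eq _
    have hy : f (toIcoMod hT 0 x + (y - x)) = f y := by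
      have : toIcoMod hT 0 x + (y - x) = y - toIcoDiv hT 0 x • T := by
        rw [toIcoMod]; ring
      rw [this]; exact hp.sub_zsmul_eq _
    have := h3.dist_le_mul (toIcoMod hT 0 x) ⟨hm.1, by linarith [hm.2]⟩
      (toIcoMod hT 0 x + (y - x)) ⟨by linarith [hm.1], by linarith [hm.2]⟩
    rw [hx, hy] at this
    rw [Real.dist_eq, abs_of_nonpos (by linarith)] at this ⊢
    refine this.trans (le_of_eq ?_)
    ring
  · have hmx := toIcoMod_mem_Ico hT 0 x
    have hmy := toIcoMod_mem_Ico hT 0 y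
    rw [zero_add] at hmx hmy
    have hx : f (toIcoMod hT 0 x) = f x := by
      rw [toIcoMod]; exact hp.sub_zsmul_eq _
    have hy : f (toIcoMod hT 0 y) = f y := by
      rw [toIcoMod]; exact hp.sub_zsmul_eq _
    have := h.dist_le_mul _ ⟨hmx.1, hmx.2.le⟩ _ ⟨hmy.1, hmy.2.le⟩
    rw [hx, hy] at this
    refine this.trans (mul_le_mul_of_nonneg_left ?_ K.coe_nonneg)
    rw [Real.dist_eq, Real.dist_eq, abs_of_nonpos (show x - y ≤ 0 by linarith)]
    rw [abs_le]
    constructor <;> linarith [hmx.1, hmx.2, hmy.1, hmy.2]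

namespace Loop

/-- The periodic extension of a closed Lipschitz path on `[0, 2π]`. -/
def ofPath (f : ℝ → E4) (hf : ∃ K : ℝ≥0, LipschitzOnWith K f (Set.Icc 0 T))
    (h0 : f 0 = f T) : Loop where
  toFun θ := f (toIcoMod T_pos 0 θ)
  lipschitz := by
    obtain ⟨K, hK⟩ := hf
    have hp : Function.Periodic (fun θ => f (toIcoMod T_pos 0 θ)) T := fun θ => by
      simp only [toIcoMod_add_right]
    refine ⟨K, lipschitz_of_periodic hp ?_⟩
    have key : ∀ θ ∈ Set.Icc (0 : ℝ) T, f (toIcoMod T_pos 0 θ) = f θ := by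
      intro θ hθ
      rcases hθ.2.lt_or_eq with h | h
      · rw [(toIcoMod_eq_self T_pos).2 ⟨hθ.1, by rwa [zero_add]⟩]
      · rw [h, ← h0]
        congr 1
        have := toIcoMod_apply_right T_pos (0 : ℝ)
        rwa [zero_add] at this
    refine LipschitzOnWith.of_dist_le_mul fun x hx y hy => ?_
    simp only [key x hx, key y hy]
    exact hK.dist_le_mul x hx y hy
  periodic := fun θ => by simp only [toIcoMod_add_right]

/-- The piece of `C` between the parameters `a` and `b`, where `C a = C b`, run through
affinely as a closed loop over `[0, 2π]`. -/
def arc (C : Loop) (a b : ℝ) (h : C a = C b) : Loop :=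
  ofPath (fun τ => C (a + (b - a) / T * τ))
    (by
      obtain ⟨K, hK⟩ := C.lipschitz
      refine ⟨K * ‖(b - a) / T‖₊, LipschitzOnWith.of_dist_le_mul fun x _ y _ => ?_⟩
      refine (hK.dist_le_mul _ _).trans (le_of_eq ?_)
      rw [dist_add_left, Real.dist_eq, Real.dist_eq, ← mul_sub, abs_mul]
      push_cast
      rw [Real.norm_eq_abs, mul_assoc])
    (by
      have : a + (b - a) / T * T = b := by
        rw [div_mul_cancel₀ _ T_pos.ne']; ring
      simp only [mul_zero, add_zero, this, h])

/-- The first parameter equivalent to `t` (modulo `2π`) that is met after `s`. -/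
def nextAfter (s t : ℝ) : ℝ := toIocMod T_pos s t

lemma apply_nextAfter (C : Loop) (s t : ℝ) : C (nextAfter s t) = C t := by
  rw [nextAfter, toIocMod]
  exact C.periodic.sub_zsmul_eq _

/-- At a self-intersection `x = C s = C t = y`, the subloop `C_{xy}`: follow `C` from the
parameter `s` until the parameter `t` is reached. -/
def splitFst (C : Loop) (s t : ℝ) (h : C s = C t) : Loop :=
  C.arc s (nextAfter s t) (h.trans (C.apply_nextAfter s t).symm)

/-- The complementary subloop `C_{yx}`: follow `C` from `t` until `s` is reached again. -/
def splitSnd (C : Loop) (s t : ℝ) (h : C s = C t) : Loop :=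
  C.arc (nextAfter s t) (s + T) (by rw [C.apply_nextAfter, C.periodic s, h])

/-- At an intersection `C s = D t` of two loops, the joined loop `C ∘ D`: go once around `C`
starting at the parameter `s`, then once around `D` starting at `t`. -/
def merge (C D : Loop) (s t : ℝ) (h : C s = D t) : Loop :=
  ofPath (fun τ => if τ ≤ T / 2 then C (s + 2 * τ) else D (t + (2 * τ - T)))
    (by
      obtain ⟨K, hK⟩ := C.lipschitz
      obtain ⟨L, hL⟩ := D.lipschitz
      refine ⟨2 * (K + L), lipschitz_glue (b := T / 2) ?_ ?_⟩
      · refine LipschitzOnWith.of_dist_le_mul fun x hx y hy => ?_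
        simp only [if_pos hx.2, if_pos hy.2]
        refine (hK.dist_le_mul _ _).trans ?_
        rw [dist_add_left, Real.dist_eq, Real.dist_eq, ← mul_sub, abs_mul, abs_two]
        push_cast
        have := mul_nonneg L.coe_nonneg (abs_nonneg (x - y))
        nlinarith
      · have key : ∀ τ ∈ Set.Icc (T / 2) T,
            (if τ ≤ T / 2 then C (s + 2 * τ) else D (t + (2 * τ - T))) =
              D (t + (2 * τ - T)) := by
          intro τ hτ
          split_ifs with hle
          · have e : τ = T / 2 := le_antisymm hle hτ.1
            have e1 : s + 2 * τ = s + T := by rw [e]; ring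
            have e2 : t + (2 * τ - T) = t := by rw [e]; ring
            rw [e1, e2, C.periodic s, h]
          · rfl
        refine LipschitzOnWith.of_dist_le_mul fun x hx y hy => ?_
        simp only [key x hx, key y hy]
        refine (hL.dist_le_mul _ _).trans ?_
        rw [dist_add_left, dist_sub_right, Real.dist_eq, Real.dist_eq, ← mul_sub, abs_mul,
          abs_two]
        push_cast
        have := mul_nonneg K.coe_nonneg (abs_nonneg (x - y))
        nlinarith)
    (by
      have hT := T_pos
      have e0 : (0 : ℝ) ≤ T / 2 := by linarith
      have e1 : ¬ T ≤ T / 2 := by linarith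
      have e2 : t + (2 * T - T) = t + T := by ring
      simp only [if_pos e0, if_neg e1, mul_zero, add_zero, e2, D.periodic t, h])

end Loop

/-! Loop calculus: functional derivatives with respect to the velocity `C'`. -/

/-- `g` is the kernel `δF/δC'_μ(θ)` at the loop `C`: for every smooth variation `h`,
`d/dt F[C + t h]` at `t = 0` equals `∮ dθ g_μ(θ) h'_μ(θ)`, up to the contribution `c_μ ∮ dθ h_μ(θ)`
of the displacement of the centre of the loop as a whole, on which the velocity `C'` does not
depend (`c = 0` for translation-invariant functionals; an `n`-loop functional, as a functional of
one of its loops, need not be translation invariant). -/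
def HasDotDeriv (F : Loop → ℂ) (C : Loop) (g : ℝ → Fin 4 → ℂ) : Prop :=
  ∃ c : Fin 4 → ℂ, ∀ h : Loop, ContDiff ℝ ∞ h.toFun →
    HasDerivAt (fun t : ℝ => F (C + t • h))
      ((∑ μ, c μ * ((∫ θ in (0 : ℝ)..T, h θ μ : ℝ) : ℂ)) +
        ∫ θ in (0 : ℝ)..T, ∑ μ, ((deriv h.toFun θ μ : ℝ) : ℂ) * g θ μ) 0

/-- Kernels without discontinuities. Since `C'` ranges over velocities with `∮ C' = 0`, a kernel is
only determined up to an additive constant, which is fixed by the normalization `∮ g = 0`. -/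
def IsContKernel (g : ℝ → Fin 4 → ℂ) : Prop :=
  Continuous g ∧ Function.Periodic g T ∧ ∫ θ in (0 : ℝ)..T, g θ = 0

/-- Normalized kernels that are continuous on the circle except for a jump at the point `b`. -/
def IsJumpKernel (b : ℝ) (g : ℝ → Fin 4 → ℂ) : Prop :=
  ContinuousOn g (Set.Ioo b (b + T)) ∧ Function.Periodic g T ∧
    (∃ r, Tendsto g (𝓝[>] b) (𝓝 r)) ∧ (∃ l, Tendsto g (𝓝[<] b) (𝓝 l)) ∧
    ∫ θ in (0 : ℝ)..T, g θ = 0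

/-- Sets of loops that are stable under every sufficiently small multiple of every smooth
variation. -/
def IsVariationOpen (U : Set Loop) : Prop :=
  ∀ C ∈ U, ∀ h : Loop, ContDiff ℝ ∞ h.toFun → ∀ᶠ t : ℝ in 𝓝 0, C + t • h ∈ U

/-- On the set `U` of loops the functional `F` has the area derivative
`A_{μν} = δF/δσ_{μν}(θ) = δ²F/(δC'_μ(θ-0) δC'_ν(θ+0)) - (μ ↔ ν)`.
Here `g X b ν` is `δF/δC'_ν(b)` and `H X b ν a μ` is `δ²F/(δC'_μ(a) δC'_ν(b))` at the loop `X`.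
The first derivative is continuous along the loop (functionals of Stokes type). -/
def HasAreaDerivOn (U : Set Loop) (F : Loop → ℂ) (θ : ℝ) (A : Loop → Fin 4 → Fin 4 → ℂ) : Prop :=
  ∃ (g : Loop → ℝ → Fin 4 → ℂ) (H : Loop → ℝ → Fin 4 → ℝ → Fin 4 → ℂ),
    ∀ X ∈ U,
      (IsContKernel (g X) ∧ HasDotDeriv F X (g X)) ∧
      (∀ b ν, IsJumpKernel b (H X b ν) ∧ HasDotDeriv (fun Y => g Y b ν) X (H X b ν)) ∧
      (∀ μ ν, Tendsto (fun p : ℝ × ℝ => H X p.2 ν p.1 μ - H X p.2 μ p.1 ν)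
        (𝓝[<] θ ×ˢ 𝓝[>] θ) (𝓝 (A X μ ν)))

/-- `𝓛 F [C]` exists and equals `ℓ`, where `𝓛` is the loop diffusion operator
`𝓛 = ∮ dθ C'_ν(θ) (δ/δC'_μ(θ+0) - δ/δC'_μ(θ-0)) δ/δσ_{μν}(θ)`.
For almost every `θ` the area derivative exists at all loops near `C` and has a kernel `k` whose
jump at `θ` is `J θ μ ν` (component `μ`). -/
def HasLoopDiffusion (F : Loop → ℂ) (C : Loop) (ℓ : ℂ) : Prop :=
  ∃ (U : Set Loop) (J : ℝ → Fin 4 → Fin 4 → ℂ), IsVariationOpen U ∧ C ∈ U ∧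
    (∀ᵐ θ : ℝ, ∃ A : Loop → Fin 4 → Fin 4 → ℂ, HasAreaDerivOn U F θ A ∧
      ∀ μ ν, ∃ k : ℝ → Fin 4 → ℂ, IsJumpKernel θ k ∧ HasDotDeriv (fun Y => A Y μ ν) C k ∧
        ∃ p q : ℂ, Tendsto (fun a => k a μ) (𝓝[>] θ) (𝓝 p) ∧
          Tendsto (fun a => k a μ) (𝓝[<] θ) (𝓝 q) ∧ J θ μ ν = p - q) ∧
    IntervalIntegrable (fun θ => ∑ μ, ∑ ν, ((deriv C.toFun θ ν : ℝ) : ℂ) * J θ μ ν) volume 0 T ∧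
    ℓ = ∫ θ in (0 : ℝ)..T, ∑ μ, ∑ ν, ((deriv C.toFun θ ν : ℝ) : ℂ) * J θ μ ν

/-- `S` is strictly additive at the intersections of loops of the class `𝒟`: both when a loop is
cut at a self-intersection and when two loops are joined at an intersection. -/
def IsStrictlyAdditive (𝒟 : Set Loop) (S : Loop → ℝ) : Prop :=
  (∀ C ∈ 𝒟, ∀ (s t : ℝ) (h : C s = C t), (∀ k : ℤ, s - t ≠ k * T) →
    S C = S (C.splitFst s t h) + S (C.splitSnd s t h)) ∧
  (∀ C ∈ 𝒟, ∀ D ∈ 𝒟, ∀ (s t : ℝ) (h : C s = D t), S (C.merge D s t h) = S C + S D)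

/-! The multiloop hierarchy. -/

/-- A sequence of functions approximating the delta function at the origin of `ℝ⁴`. -/
structure IsDeltaSequence (ρ : ℕ → E4 → ℝ) : Prop where
  continuous : ∀ k, Continuous (ρ k)
  nonneg : ∀ k x, 0 ≤ ρ k x
  integrable : ∀ k, Integrable (ρ k)
  integral_eq_one : ∀ k, ∫ x, ρ k x = 1
  support_shrinks : ∀ r > 0, ∀ᶠ k in atTop, Function.support (ρ k) ⊆ Metric.ball 0 r

/-- The bilocal integral
`lam ∬ dθ₁ dθ₂ C'(θ₁) · D'(θ₂) δ(C(θ₁) - D(θ₂)) F(θ₁, θ₂)` with the regularized delta `r`. -/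
def bilocal (lam : ℝ) (r : E4 → ℝ) (C D : Loop) (F : ℝ → ℝ → ℂ) : ℂ :=
  lam * ∫ s in (0 : ℝ)..T, ∫ t in (0 : ℝ)..T,
    ((inner ℝ (deriv C.toFun s) (deriv D.toFun t) * r (C s - D t) : ℝ) : ℂ) * F s t

/-- Continuous functions on the torus of pairs of parameters. -/
def IsTorusFun (F : ℝ → ℝ → ℂ) : Prop :=
  Continuous (Function.uncurry F) ∧ ∀ s t, F (s + T) t = F s t ∧ F s (t + T) = F s t

/-- The bilocal integral over the intersections of two distinct loops of a quantity `f`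
defined at the intersections only exists and equals `I`: replace `f` by any continuous
function that agrees with it at the intersections, and remove the regularization. -/
def HasContactIntegral (lam : ℕ → ℝ) (ρ : ℕ → E4 → ℝ) (C D : Loop)
    (f : ∀ s t : ℝ, C s = D t → ℂ) (I : ℂ) : Prop :=
  (∃ F, IsTorusFun F ∧ ∀ s t (h : C s = D t), F s t = f s t h) ∧
  ∀ F, IsTorusFun F → (∀ s t (h : C s = D t), F s t = f s t h) →
    Tendsto (fun k => bilocal (lam k) (ρ k) C D F) atTop (𝓝 I)

/-- Admissible extensions for self-intersections: they agree with `f` at all self-intersections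
`C s = C t` with `s ≠ t` modulo `2π` and vanish near the diagonal `s = t`. -/
def IsSelfExtension (C : Loop) (f : ∀ s t : ℝ, C s = C t → ℂ) (F : ℝ → ℝ → ℂ) : Prop :=
  IsTorusFun F ∧
  (∃ r > 0, ∀ s t : ℝ, ∀ k : ℤ, |s - t - k * T| < r → F s t = 0) ∧
  ∀ s t (h : C s = C t), (∀ k : ℤ, s - t ≠ k * T) → F s t = f s t h

/-- The bilocal integral over the self-intersections of one loop, the coincidence `s = t` being
excluded. -/
def HasSelfContactIntegral (lam : ℕ → ℝ) (ρ : ℕ → E4 → ℝ) (C : Loop)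
    (f : ∀ s t : ℝ, C s = C t → ℂ) (I : ℂ) : Prop :=
  (∃ F, IsSelfExtension C f F) ∧
  ∀ F, IsSelfExtension C f F → Tendsto (fun k => bilocal (lam k) (ρ k) C C F) atTop (𝓝 I)

/-- The family of `n`-loop functionals `W n`; only `n ≥ 1` matters. -/
abbrev LoopFamily : Type := ∀ n : ℕ, (Fin n → Loop) → ℂ

/-- `W_{n+1}(…, C^i_{xy}, …, C^i_{yx}) - N⁻² W_n(C)` at a self-intersection of `C^i`. -/
def splitTerm (N : ℕ) (W : LoopFamily) {n : ℕ} (C : Fin n → Loop) (i : Fin n)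
    (s t : ℝ) (h : C i s = C i t) : ℂ :=
  W (n + 1) (Fin.snoc (α := fun _ => Loop) (Function.update C i ((C i).splitFst s t h))
    ((C i).splitSnd s t h)) - 1 / (N : ℂ) ^ 2 * W n C

/-- `N⁻² (W_{n-1}(…, C^i ∘ C^j, …) - W_n(C))` at an intersection of `C^i` and `C^j`, where
`n = m + 1`: the loop `C^i` is replaced by the joined loop and `C^j` is removed. -/
def mergeTerm (N : ℕ) (W : LoopFamily) {m : ℕ} (C : Fin (m + 1) → Loop) (i j : Fin (m + 1))
    (s t : ℝ) (h : C i s = C j t) : ℂ :=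
  1 / (N : ℂ) ^ 2 *
    (W m (Fin.removeNth (α := fun _ => Loop) j
      (Function.update C i ((C i).merge (C j) s t h))) - W (m + 1) C)

/-- The Makeenko-Migdal multiloop hierarchy for `SU(N)`: for every number `n = m + 1 ≥ 1` of loops
and every `i`, with `𝓛` acting on the `i`-th loop,
`𝓛_i W_n = lam ∬ C_i'·C_i' δ(C_i - C_i) (W_{n+1} - N⁻² W_n)
  + lam ∑_{j ≠ i} ∬ C_i'·C_j' δ(C_i - C_j) N⁻² (W_{n-1} - W_n)`.
The equation is imposed on the configurations of loops of the class `𝒟` for which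
the right-hand side exists; `lam k` is the bare coupling that belongs to the regularization `ρ k`
of the delta function. -/
def SatisfiesHierarchy (N : ℕ) (lam : ℕ → ℝ) (ρ : ℕ → E4 → ℝ) (𝒟 : Set Loop)
    (W : LoopFamily) : Prop :=
  ∀ (m : ℕ) (C : Fin (m + 1) → Loop), (∀ j, C j ∈ 𝒟) →
    ∀ (i : Fin (m + 1)) (I : Fin (m + 1) → ℂ),
      HasSelfContactIntegral lam ρ (C i) (splitTerm N W C i) (I i) →
      (∀ j, j ≠ i → HasContactIntegral lam ρ (C i) (C j) (mergeTerm N W C i j) (I j)) →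
      HasLoopDiffusion (fun γ => W (m + 1) (Function.update C i γ)) (C i) (∑ j, I j)

/-- The dressed functionals `W_n(C) exp(-κ ∑ᵢ S[C_i])`. -/
def dress (κ : ℝ) (S : Loop → ℝ) (W : LoopFamily) : LoopFamily :=
  fun n C => W n C * ((Real.exp (-κ * ∑ i : Fin n, S (C i)) : ℝ) : ℂ)

end LoopEq

end

namespace LoopEq

/-! ### Loops as points of an affine variation. -/

namespace Loop

/-! The operator `𝓛` is formally of third order, yet it acts as a derivation on functionals whose
first derivative is continuous along the loop. In the second derivative of a product, the cross
terms are products of two first kernels. When both points tend to `θ` these become symmetric in `μ,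
ν` and drop out of the area derivative. One further derivative produces cross terms of the form
(area derivative) × (continuous first kernel), which have no jump at `θ`. This gives the Leibniz
rule `HasLoopDiffusion.mul` and, by the same cancellations, the chain rule `HasLoopDiffusion.comp`.
Since `𝓛 S = 0`, the exponential weight is annihilated by `𝓛_i`, so dressing multiplies the
left-hand side by the weight.

On the right-hand side, additivity keeps the total `S` unchanged under every cut and join. All
contact terms at a given configuration therefore acquire the same nonzero factor (`splitTerm_dress`,
`mergeTerm_dress`). Dividing by it turns existing dressed contact integrals into existing undressed
ones, to which the hierarchy for `W` applies. -/

@[ext]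
lemma ext {C D : Loop} (h : ∀ θ, C θ = D θ) : C = D := by
  cases C
  cases D
  congr
  exact funext h

lemma add_zero_smul (C h : Loop) : C + (0 : ℝ) • h = C := by
  ext1 θ
  change C θ + (0 : ℝ) • h θ = C θ
  simp

end Loop

/-! Kernels. -/

lemma IsContKernel.intervalIntegrable {g : ℝ → Fin 4 → ℂ} (hg : IsContKernel g) :
    IntervalIntegrable g volume 0 T :=
  hg.1.intervalIntegrable 0 T

lemma IsContKernel.isJumpKernel {g : ℝ → Fin 4 → ℂ} (hg : IsContKernel g) (b : ℝ) :
    IsJumpKernel b g :=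
  ⟨hg.1.continuousOn, hg.2.1, ⟨g b, hg.1.continuousWithinAt⟩, ⟨g b, hg.1.continuousWithinAt⟩,
    hg.2.2⟩

lemma IsContKernel.smul {g : ℝ → Fin 4 → ℂ} (hg : IsContKernel g) (c : ℂ) :
    IsContKernel (c • g) := by
  refine ⟨hg.1.const_smul c, hg.2.1.smul c, ?_⟩
  simp [hg.2.2]

lemma IsContKernel.add {g k : ℝ → Fin 4 → ℂ} (hg : IsContKernel g) (hk : IsContKernel k) :
    IsContKernel (g + k) := by
  refine ⟨hg.1.add hk.1, hg.2.1.add hk.2.1, ?_⟩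
  simp only [Pi.add_apply]
  rw [intervalIntegral.integral_add hg.intervalIntegrable hk.intervalIntegrable, hg.2.2, hk.2.2,
    add_zero]

/-- Periodicity carries the left limit at `b` to `b + T`, so the kernel extends continuously from
the open period to the closed one; its value at `b` itself is irrelevant. -/
lemma IsJumpKernel.intervalIntegrable {b : ℝ} {g : ℝ → Fin 4 → ℂ} (hg : IsJumpKernel b g) :
    IntervalIntegrable g volume 0 T := by
  obtain ⟨hc, hp, ⟨r, hr⟩, ⟨l, hl⟩, -⟩ := hg
  have hlt : b < b + T := lt_add_of_pos_right b T_pos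
  have hl' : Tendsto g (𝓝[<] (b + T)) (𝓝 l) := by
    have hs : Tendsto (fun x => x - T) (𝓝[<] (b + T)) (𝓝[<] b) := by
      refine tendsto_nhdsWithin_iff.2 ⟨?_, ?_⟩
      · have : Tendsto (fun x : ℝ => x - T) (𝓝 (b + T)) (𝓝 (b + T - T)) :=
          (continuous_id.sub continuous_const).tendsto _
        rw [add_sub_cancel_right] at this
        exact this.mono_left nhdsWithin_le_nhds
      · filter_upwards [self_mem_nhdsWithin] with x hx
        exact sub_lt_iff_lt_add.2 (Set.mem_Iio.1 hx)
    refine (hl.comp hs).congr fun x => ?_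
    exact hp.sub_eq x
  have hext := continuousOn_Icc_extendFrom_Ioo hc hr hl'
  have hint : IntervalIntegrable g volume b (b + T) := by
    refine (hext.intervalIntegrable_of_Icc hlt.le).congr_ae ?_
    rw [Set.uIoc_of_le hlt.le, ← restrict_Ioo_eq_restrict_Ioc]
    filter_upwards [ae_restrict_mem measurableSet_Ioo] with x hx
    exact extendFrom_eq (subset_closure hx) (hc x hx)
  exact hp.intervalIntegrable T_pos.ne' hint 0 T

lemma IsJumpKernel.smul {b : ℝ} {g : ℝ → Fin 4 → ℂ} (hg : IsJumpKernel b g) (c : ℂ) :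
    IsJumpKernel b (c • g) := by
  obtain ⟨hc, hp, ⟨r, hr⟩, ⟨l, hl⟩, h0⟩ := hg
  refine ⟨hc.const_smul c, hp.smul c, ⟨c • r, hr.const_smul c⟩, ⟨c • l, hl.const_smul c⟩, ?_⟩
  simp [h0]

lemma IsJumpKernel.add {b : ℝ} {g k : ℝ → Fin 4 → ℂ} (hg : IsJumpKernel b g)
    (hk : IsJumpKernel b k) : IsJumpKernel b (g + k) := by
  have hi := intervalIntegral.integral_add hg.intervalIntegrable hk.intervalIntegrable
  obtain ⟨hc, hp, ⟨r, hr⟩, ⟨l, hl⟩, h0⟩ := hg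
  obtain ⟨hc', hp', ⟨r', hr'⟩, ⟨l', hl'⟩, h0'⟩ := hk
  refine ⟨ContinuousOn.add hc hc', hp.add hp', ⟨r + r', Tendsto.add hr hr'⟩,
    ⟨l + l', Tendsto.add hl hl'⟩, ?_⟩
  simp only [Pi.add_apply]
  rw [hi, h0, h0', add_zero]

/-! Rules of differentiation. -/

lemma intervalIntegrable_deriv_mul {h : Loop} (hh : ContDiff ℝ ∞ h.toFun) {g : ℝ → Fin 4 → ℂ}
    (hg : IntervalIntegrable g volume 0 T) :
    IntervalIntegrable (fun θ => ∑ μ, ((deriv h.toFun θ μ : ℝ) : ℂ) * g θ μ) volume 0 T := by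
  have hd : Continuous (deriv h.toFun) := hh.continuous_deriv (by simp)
  suffices key : ∀ μ, IntervalIntegrable (fun θ => ((deriv h.toFun θ μ : ℝ) : ℂ) * g θ μ)
      volume 0 T by
    simpa only [Finset.sum_fn] using IntervalIntegrable.sum Finset.univ fun μ _ => key μ
  intro μ
  refine IntervalIntegrable.continuousOn_mul (f := fun θ => g θ μ) ?_ ?_
  · exact ⟨hg.1.eval μ, hg.2.eval μ⟩
  · exact (by fun_prop : Continuous fun θ => ((deriv h.toFun θ μ : ℝ) : ℂ)).continuousOn

lemma HasDotDeriv.smul {F : Loop → ℂ} {C : Loop} {g : ℝ → Fin 4 → ℂ} (hF : HasDotDeriv F C g)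
    (a : ℂ) : HasDotDeriv (fun X => a * F X) C (a • g) := by
  obtain ⟨c, hc⟩ := hF
  refine ⟨a • c, fun h hh => ?_⟩
  refine ((hc h hh).const_mul a).congr_deriv ?_
  rw [mul_add, Finset.mul_sum, ← intervalIntegral.integral_const_mul]
  simp only [Pi.smul_apply, smul_eq_mul, Finset.mul_sum, mul_assoc, mul_left_comm]

lemma HasDotDeriv.add {F G : Loop → ℂ} {C : Loop} {g k : ℝ → Fin 4 → ℂ}
    (hF : HasDotDeriv F C g) (hG : HasDotDeriv G C k) (hg : IntervalIntegrable g volume 0 T)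
    (hk : IntervalIntegrable k volume 0 T) : HasDotDeriv (fun X => F X + G X) C (g + k) := by
  obtain ⟨c, hc⟩ := hF
  obtain ⟨d, hd⟩ := hG
  refine ⟨c + d, fun h hh => ?_⟩
  refine ((hc h hh).add (hd h hh)).congr_deriv ?_
  simp only [Pi.add_apply, mul_add, add_mul, Finset.sum_add_distrib]
  rw [intervalIntegral.integral_add (intervalIntegrable_deriv_mul hh hg)
    (intervalIntegrable_deriv_mul hh hk)]
  ring

/-- The chain rule. -/
lemma HasDotDeriv.comp {F : Loop → ℂ} {C : Loop} {g : ℝ → Fin 4 → ℂ} (hF : HasDotDeriv F C g)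
    {f : ℂ → ℂ} {f' : ℂ} (hf : HasDerivAt f f' (F C)) :
    HasDotDeriv (fun X => f (F X)) C (f' • g) := by
  obtain ⟨c, hc⟩ := hF.smul f'
  obtain ⟨d, hd⟩ := hF
  refine ⟨c, fun h hh => ?_⟩
  have h1 := hc h hh
  have h2 := hd h hh
  have h3 := h1.unique (h2.const_mul f')
  rw [h3]
  refine HasDerivAt.comp (0 : ℝ) (h₂ := f) (h := fun t : ℝ => F (C + t • h)) ?_ h2
  rwa [Loop.add_zero_smul]

/-- The product rule. -/
lemma HasDotDeriv.mul {F G : Loop → ℂ} {C : Loop} {g k : ℝ → Fin 4 → ℂ}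
    (hF : HasDotDeriv F C g) (hG : HasDotDeriv G C k) (hg : IntervalIntegrable g volume 0 T)
    (hk : IntervalIntegrable k volume 0 T) :
    HasDotDeriv (fun X => F X * G X) C (G C • g + F C • k) := by
  obtain ⟨e, he⟩ := (hF.smul (G C)).add (hG.smul (F C)) (hg.smul _) (hk.smul _)
  obtain ⟨c, hc⟩ := hF
  obtain ⟨d, hd⟩ := hG
  refine ⟨e, fun h hh => ?_⟩
  -- The linear functional `G C * F + F C * G`, with coefficients frozen at `C`, has the same
  -- derivative at `C` as the product and already carries the required kernel.
  have h1 := (he h hh).unique (((hc h hh).const_mul (G C)).add ((hd h hh).const_mul (F C)))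
  rw [h1]
  refine ((hc h hh).mul (hd h hh)).congr_deriv ?_
  rw [Loop.add_zero_smul]
  ring

/-! The area derivative and the loop diffusion operator are derivations. -/

lemma IsVariationOpen.inter {U V : Set Loop} (hU : IsVariationOpen U) (hV : IsVariationOpen V) :
    IsVariationOpen (U ∩ V) :=
  fun C hC h hh => (hU C hC.1 h hh).and (hV C hC.2 h hh)

lemma HasAreaDerivOn.mono {U V : Set Loop} {F : Loop → ℂ} {θ : ℝ}
    {A : Loop → Fin 4 → Fin 4 → ℂ} (h : HasAreaDerivOn U F θ A) (hVU : V ⊆ U) :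
    HasAreaDerivOn V F θ A := by
  obtain ⟨g, H, hgH⟩ := h
  exact ⟨g, H, fun X hX => hgH X (hVU hX)⟩

lemma HasAreaDerivOn.exists_hasDotDeriv {U : Set Loop} {F : Loop → ℂ} {θ : ℝ}
    {A : Loop → Fin 4 → Fin 4 → ℂ} (h : HasAreaDerivOn U F θ A) {X : Loop} (hX : X ∈ U) :
    ∃ g, IsContKernel g ∧ HasDotDeriv F X g := by
  obtain ⟨g, H, hgH⟩ := h
  exact ⟨g X, (hgH X hX).1⟩

lemma IsContKernel.tendsto_right {g : ℝ → Fin 4 → ℂ} (hg : IsContKernel g) (θ : ℝ)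
    (μ : Fin 4) : Tendsto (fun a => g a μ) (𝓝[>] θ) (𝓝 (g θ μ)) :=
  ((continuous_apply μ).comp hg.1).continuousWithinAt

lemma IsContKernel.tendsto_left {g : ℝ → Fin 4 → ℂ} (hg : IsContKernel g) (θ : ℝ)
    (μ : Fin 4) : Tendsto (fun a => g a μ) (𝓝[<] θ) (𝓝 (g θ μ)) :=
  ((continuous_apply μ).comp hg.1).continuousWithinAt

lemma IsContKernel.tendsto_fst {g : ℝ → Fin 4 → ℂ} (hg : IsContKernel g) (θ : ℝ) (μ : Fin 4) :
    Tendsto (fun p : ℝ × ℝ => g p.1 μ) (𝓝[<] θ ×ˢ 𝓝[>] θ) (𝓝 (g θ μ)) :=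
  (hg.tendsto_left θ μ).comp Filter.tendsto_fst

lemma IsContKernel.tendsto_snd {g : ℝ → Fin 4 → ℂ} (hg : IsContKernel g) (θ : ℝ) (μ : Fin 4) :
    Tendsto (fun p : ℝ × ℝ => g p.2 μ) (𝓝[<] θ ×ˢ 𝓝[>] θ) (𝓝 (g θ μ)) :=
  (hg.tendsto_right θ μ).comp Filter.tendsto_snd

lemma HasAreaDerivOn.mul {U : Set Loop} {F G : Loop → ℂ} {θ : ℝ}
    {A B : Loop → Fin 4 → Fin 4 → ℂ} (hF : HasAreaDerivOn U F θ A)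
    (hG : HasAreaDerivOn U G θ B) :
    HasAreaDerivOn U (fun X => F X * G X) θ (fun X => G X • A X + F X • B X) := by
  obtain ⟨g, H, hgH⟩ := hF
  obtain ⟨k, K, hkK⟩ := hG
  refine ⟨fun X => G X • g X + F X • k X,
    fun X b ν => (g X b ν • k X + G X • H X b ν) + (k X b ν • g X + F X • K X b ν),
    fun X hX => ?_⟩
  obtain ⟨⟨hg, hFg⟩, hH, hA⟩ := hgH X hX
  obtain ⟨⟨hk, hGk⟩, hK, hB⟩ := hkK X hX
  refine ⟨⟨(hg.smul _).add (hk.smul _),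
    hFg.mul hGk hg.intervalIntegrable hk.intervalIntegrable⟩, fun b ν => ?_, fun μ ν => ?_⟩
  · have h1 := ((hk.isJumpKernel b).smul (g X b ν)).add ((hH b ν).1.smul (G X))
    have h2 := ((hg.isJumpKernel b).smul (k X b ν)).add ((hK b ν).1.smul (F X))
    exact ⟨h1.add h2,
      (hGk.mul (hH b ν).2 hk.intervalIntegrable (hH b ν).1.intervalIntegrable).add
        (hFg.mul (hK b ν).2 hg.intervalIntegrable (hK b ν).1.intervalIntegrable)
        h1.intervalIntegrable h2.intervalIntegrable⟩
  -- `h1` and `h2` are the cross terms for `(μ, ν)` and `(ν, μ)`. By continuity of `g` and `k` at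
  -- `θ` their limits coincide, so `h1.sub h2` contributes zero.
  · have h1 := ((hg.tendsto_snd θ ν).mul (hk.tendsto_fst θ μ)).add
      ((hk.tendsto_snd θ ν).mul (hg.tendsto_fst θ μ))
    have h2 := ((hg.tendsto_snd θ μ).mul (hk.tendsto_fst θ ν)).add
      ((hk.tendsto_snd θ μ).mul (hg.tendsto_fst θ ν))
    have h3 := (((hA μ ν).const_mul (G X)).add ((hB μ ν).const_mul (F X))).add (h1.sub h2)
    convert h3 using 1
    · ext p
      simp only [Pi.add_apply, Pi.smul_apply, smul_eq_mul]
      ring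
    · simp only [Pi.add_apply, Pi.smul_apply, smul_eq_mul]
      congr 1
      ring

/-- The only extra term is `f''(F) g_μ(a) g_ν(b)`, whose limit is symmetric in `μ, ν`.
Differentiability over `ℂ` also supplies the second derivative of `f`. -/
lemma HasAreaDerivOn.comp {U : Set Loop} {F : Loop → ℂ} {θ : ℝ}
    {A : Loop → Fin 4 → Fin 4 → ℂ} (hF : HasAreaDerivOn U F θ A) {f : ℂ → ℂ}
    (hf : Differentiable ℂ f) :
    HasAreaDerivOn U (fun X => f (F X)) θ (fun X => deriv f (F X) • A X) := by
  obtain ⟨g, H, hgH⟩ := hF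
  have hf' : Differentiable ℂ (deriv f) := hf.deriv
  refine ⟨fun X => deriv f (F X) • g X,
    fun X b ν => g X b ν • deriv (deriv f) (F X) • g X + deriv f (F X) • H X b ν,
    fun X hX => ?_⟩
  obtain ⟨⟨hg, hFg⟩, hH, hA⟩ := hgH X hX
  refine ⟨⟨hg.smul _, hFg.comp (hf _).hasDerivAt⟩, fun b ν => ?_, fun μ ν => ?_⟩
  · have hg' := hg.smul (deriv (deriv f) (F X))
    exact ⟨((hg'.isJumpKernel b).smul _).add ((hH b ν).1.smul _),
      (hFg.comp (hf' _).hasDerivAt).mul (hH b ν).2 hg'.intervalIntegrable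
        (hH b ν).1.intervalIntegrable⟩
  · have h1 := (hg.tendsto_snd θ ν).mul (hg.tendsto_fst θ μ)
    have h2 := (hg.tendsto_snd θ μ).mul (hg.tendsto_fst θ ν)
    have h3 := ((hA μ ν).const_mul (deriv f (F X))).add
      ((h1.sub h2).const_mul (deriv (deriv f) (F X)))
    convert h3 using 1
    · ext p
      simp only [Pi.add_apply, Pi.smul_apply, smul_eq_mul]
      ring
    · simp only [Pi.smul_apply, smul_eq_mul]
      congr 1
      ring

lemma HasLoopDiffusion.mul {F G : Loop → ℂ} {C : Loop} {ℓ m : ℂ} (hF : HasLoopDiffusion F C ℓ)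
    (hG : HasLoopDiffusion G C m) :
    HasLoopDiffusion (fun X => F X * G X) C (G C * ℓ + F C * m) := by
  obtain ⟨U, J, hU, hCU, hJ, hJi, rfl⟩ := hF
  obtain ⟨V, K, hV, hCV, hK, hKi, rfl⟩ := hG
  have hsum : ∀ θ, ∑ μ, ∑ ν, ((deriv C.toFun θ ν : ℝ) : ℂ) * (G C • J θ + F C • K θ) μ ν =
      G C * (∑ μ, ∑ ν, ((deriv C.toFun θ ν : ℝ) : ℂ) * J θ μ ν) +
        F C * ∑ μ, ∑ ν, ((deriv C.toFun θ ν : ℝ) : ℂ) * K θ μ ν := by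
    intro θ
    simp only [Finset.mul_sum, ← Finset.sum_add_distrib, Pi.add_apply, Pi.smul_apply,
      smul_eq_mul]
    exact Finset.sum_congr rfl fun μ _ => Finset.sum_congr rfl fun ν _ => by ring
  refine ⟨U ∩ V, fun θ => G C • J θ + F C • K θ, hU.inter hV, ⟨hCU, hCV⟩, ?_, ?_, ?_⟩
  · filter_upwards [hJ, hK] with θ hJθ hKθ
    obtain ⟨A, hA, hAk⟩ := hJθ
    obtain ⟨B, hB, hBk⟩ := hKθ
    obtain ⟨g, hg, hFg⟩ := hA.exists_hasDotDeriv hCU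
    obtain ⟨k, hk, hGk⟩ := hB.exists_hasDotDeriv hCV
    refine ⟨_, (hA.mono Set.inter_subset_left).mul (hB.mono Set.inter_subset_right),
      fun μ ν => ?_⟩
    obtain ⟨a, ha, hAa, p, q, hp, hq, hpq⟩ := hAk μ ν
    obtain ⟨b, hb, hBb, p', q', hp', hq', hpq'⟩ := hBk μ ν
    -- Of the two summands here, and in `h2`, only the second can jump at `θ`: the first is a
    -- constant times a continuous first kernel, so it cancels in the difference of one-sided
    -- limits.
    have h1 := ((hk.isJumpKernel θ).smul (A C μ ν)).add (ha.smul (G C))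
    have h2 := ((hg.isJumpKernel θ).smul (B C μ ν)).add (hb.smul (F C))
    refine ⟨_, h1.add h2, (hGk.mul hAa hk.intervalIntegrable ha.intervalIntegrable).add
      (hFg.mul hBb hg.intervalIntegrable hb.intervalIntegrable)
      h1.intervalIntegrable h2.intervalIntegrable, _, _,
      (((hk.tendsto_right θ μ).const_mul (A C μ ν)).add (hp.const_mul (G C))).add
        (((hg.tendsto_right θ μ).const_mul (B C μ ν)).add (hp'.const_mul (F C))),
      (((hk.tendsto_left θ μ).const_mul (A C μ ν)).add (hq.const_mul (G C))).add
        (((hg.tendsto_left θ μ).const_mul (B C μ ν)).add (hq'.const_mul (F C))), ?_⟩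
    simp only [Pi.add_apply, Pi.smul_apply, smul_eq_mul, hpq, hpq']
    ring
  · simp only [hsum]
    exact (hJi.const_mul _).add (hKi.const_mul _)
  · simp only [hsum]
    rw [intervalIntegral.integral_add (hJi.const_mul _) (hKi.const_mul _),
      intervalIntegral.integral_const_mul, intervalIntegral.integral_const_mul]

lemma HasLoopDiffusion.comp {F : Loop → ℂ} {C : Loop} {ℓ : ℂ} (hF : HasLoopDiffusion F C ℓ)
    {f : ℂ → ℂ} (hf : Differentiable ℂ f) :
    HasLoopDiffusion (fun X => f (F X)) C (deriv f (F C) * ℓ) := by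
  obtain ⟨U, J, hU, hCU, hJ, hJi, rfl⟩ := hF
  have hsum : ∀ θ, ∑ μ, ∑ ν, ((deriv C.toFun θ ν : ℝ) : ℂ) * (deriv f (F C) • J θ) μ ν =
      deriv f (F C) * ∑ μ, ∑ ν, ((deriv C.toFun θ ν : ℝ) : ℂ) * J θ μ ν := by
    intro θ
    simp only [Finset.mul_sum, Pi.smul_apply, smul_eq_mul, mul_left_comm]
  refine ⟨U, fun θ => deriv f (F C) • J θ, hU, hCU, ?_, ?_, ?_⟩
  · filter_upwards [hJ] with θ hJθ
    obtain ⟨A, hA, hAk⟩ := hJθ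
    obtain ⟨g, hg, hFg⟩ := hA.exists_hasDotDeriv hCU
    refine ⟨_, hA.comp hf, fun μ ν => ?_⟩
    obtain ⟨a, ha, hAa, p, q, hp, hq, hpq⟩ := hAk μ ν
    -- Kernel of the prefactor `f'(F)`; it is continuous, hence invisible to the jump.
    have hg' := hg.smul (deriv (deriv f) (F C))
    refine ⟨_, ((hg'.isJumpKernel θ).smul (A C μ ν)).add (ha.smul (deriv f (F C))),
      (hFg.comp (hf.deriv _).hasDerivAt).mul hAa hg'.intervalIntegrable ha.intervalIntegrable,
      _, _, ((hg'.tendsto_right θ μ).const_mul (A C μ ν)).add (hp.const_mul (deriv f (F C))),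
      ((hg'.tendsto_left θ μ).const_mul (A C μ ν)).add (hq.const_mul (deriv f (F C))), ?_⟩
    simp only [Pi.smul_apply, smul_eq_mul, hpq]
    ring
  · simp only [hsum]
    exact hJi.const_mul _
  · simp only [hsum]
    rw [intervalIntegral.integral_const_mul]

/-! Contact integrals are linear in the contact term. -/

lemma bilocal_const_mul (lam : ℝ) (r : E4 → ℝ) (C D : Loop) (F : ℝ → ℝ → ℂ) (a : ℂ) :
    bilocal lam r C D (fun s t => a * F s t) = a * bilocal lam r C D F := by
  simp only [bilocal, mul_left_comm _ a, intervalIntegral.integral_const_mul]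

lemma IsTorusFun.const_mul {F : ℝ → ℝ → ℂ} (hF : IsTorusFun F) (a : ℂ) :
    IsTorusFun (fun s t => a * F s t) :=
  ⟨continuous_const.mul hF.1, fun s t => by simp only [hF.2 s t, and_self]⟩

lemma IsSelfExtension.const_mul {C : Loop} {f f' : ∀ s t : ℝ, C s = C t → ℂ} {F : ℝ → ℝ → ℂ}
    (hF : IsSelfExtension C f F) (a : ℂ)
    (hf : ∀ s t (h : C s = C t), (∀ k : ℤ, s - t ≠ k * T) → f' s t h = a * f s t h) :
    IsSelfExtension C f' (fun s t => a * F s t) := by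
  obtain ⟨h1, ⟨r, hr, h2⟩, h3⟩ := hF
  refine ⟨h1.const_mul a, ⟨r, hr, fun s t k hk => ?_⟩, fun s t h hk => ?_⟩
  · simp only [h2 s t k hk, mul_zero]
  · simp only [h3 s t h hk, hf s t h hk]

/-- The limit must be checked for every extension of `f'`, and division by `a` turns each into an
extension of `f`; this is where `a ≠ 0` enters. Proportionality is asked only off the diagonal,
where additivity of `S` is available. -/
lemma HasSelfContactIntegral.const_mul {lam : ℕ → ℝ} {ρ : ℕ → E4 → ℝ} {C : Loop}
    {f f' : ∀ s t : ℝ, C s = C t → ℂ} {I : ℂ} (hI : HasSelfContactIntegral lam ρ C f I)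
    {a : ℂ} (ha : a ≠ 0)
    (hf : ∀ s t (h : C s = C t), (∀ k : ℤ, s - t ≠ k * T) → f' s t h = a * f s t h) :
    HasSelfContactIntegral lam ρ C f' (a * I) := by
  obtain ⟨⟨F, hF⟩, hlim⟩ := hI
  refine ⟨⟨_, hF.const_mul a hf⟩, fun F' hF' => ?_⟩
  have hF'' : IsSelfExtension C f (fun s t => a⁻¹ * F' s t) :=
    hF'.const_mul a⁻¹ fun s t h hk => by rw [hf s t h hk, inv_mul_cancel_left₀ ha]
  refine ((hlim _ hF'').const_mul a).congr fun k => ?_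
  rw [bilocal_const_mul, mul_inv_cancel_left₀ ha]

lemma HasContactIntegral.const_mul {lam : ℕ → ℝ} {ρ : ℕ → E4 → ℝ} {C D : Loop}
    {f f' : ∀ s t : ℝ, C s = D t → ℂ} {I : ℂ} (hI : HasContactIntegral lam ρ C D f I)
    {a : ℂ} (ha : a ≠ 0) (hf : ∀ s t (h : C s = D t), f' s t h = a * f s t h) :
    HasContactIntegral lam ρ C D f' (a * I) := by
  obtain ⟨⟨F, hF, hFf⟩, hlim⟩ := hI
  refine ⟨⟨_, hF.const_mul a, fun s t h => by rw [hFf, hf]⟩, fun F' hF' hFf' => ?_⟩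
  refine ((hlim _ (hF'.const_mul a⁻¹) fun s t h => ?_).const_mul a).congr fun k => ?_
  · rw [hFf', hf, inv_mul_cancel_left₀ ha]
  · rw [bilocal_const_mul, mul_inv_cancel_left₀ ha]

/-! Dressing of the contact terms. -/

lemma sum_update (S : Loop → ℝ) {n : ℕ} (C : Fin n → Loop) (i : Fin n) (X : Loop) :
    ∑ k, S (Function.update C i X k) = ∑ k, S (C k) - S (C i) + S X := by
  have h : ∀ Y : Loop, ∑ k, S (Function.update C i Y k) =
      S Y + ∑ k ∈ Finset.univ.erase i, S (C k) := by
    intro Y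
    rw [← Finset.add_sum_erase _ _ (Finset.mem_univ i), Function.update_self]
    congr 1
    refine Finset.sum_congr rfl fun k hk => ?_
    rw [Function.update_of_ne (Finset.ne_of_mem_erase hk)]
  have h' := h (C i)
  rw [Function.update_eq_self] at h'
  rw [h X, h']
  ring

/-- The two pieces carry together the `S` of the loop they come from, so `W (n + 1)` and `W n` are
dressed by one and the same weight. -/
lemma splitTerm_dress (N : ℕ) (κ : ℝ) {S : Loop → ℝ} (W : LoopFamily) {n : ℕ}
    (C : Fin n → Loop) (i : Fin n) (s t : ℝ) (h : C i s = C i t)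
    (hS : S (C i) = S ((C i).splitFst s t h) + S ((C i).splitSnd s t h)) :
    splitTerm N (dress κ S W) C i s t h =
      ((Real.exp (-κ * ∑ k, S (C k)) : ℝ) : ℂ) * splitTerm N W C i s t h := by
  have hsum : ∑ k, S (Fin.snoc (α := fun _ => Loop)
      (Function.update C i ((C i).splitFst s t h)) ((C i).splitSnd s t h) k) =
      ∑ k, S (C k) := by
    rw [Fin.sum_univ_castSucc]
    simp only [Fin.snoc_castSucc, Fin.snoc_last, sum_update]
    rw [hS]
    ring
  simp only [splitTerm, dress, hsum]
  ring

lemma mergeTerm_dress (N : ℕ) (κ : ℝ) {S : Loop → ℝ} (W : LoopFamily) {m : ℕ}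
    (C : Fin (m + 1) → Loop) {i j : Fin (m + 1)} (hij : j ≠ i) (s t : ℝ) (h : C i s = C j t)
    (hS : S ((C i).merge (C j) s t h) = S (C i) + S (C j)) :
    mergeTerm N (dress κ S W) C i j s t h =
      ((Real.exp (-κ * ∑ k, S (C k)) : ℝ) : ℂ) * mergeTerm N W C i j s t h := by
  have hsum : ∑ k, S (Fin.removeNth (α := fun _ => Loop) j
      (Function.update C i ((C i).merge (C j) s t h)) k) = ∑ k, S (C k) := by
    have h1 := sum_update S C i ((C i).merge (C j) s t h)
    -- Since `j ≠ i`, the updated family still has `C j` at position `j`; removing it compensates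
    -- the `S (C j)` gained by the joined loop.
    rw [Fin.sum_univ_succAbove _ j, Function.update_of_ne hij, hS] at h1
    simp only [Fin.removeNth]
    linarith
  simp only [mergeTerm, dress, hsum]
  ring

end LoopEq

/-! ### The dressing symmetry. -/

theorem theorem2p1 (N : ℕ) (hN : 1 ≤ N) (lam : ℕ → ℝ)
    (ρ : ℕ → LoopEq.E4 → ℝ) (hρ : LoopEq.IsDeltaSequence ρ)
    (𝒟 : Set LoopEq.Loop) (S : LoopEq.Loop → ℝ)
    (hzero : ∀ C ∈ 𝒟, LoopEq.HasLoopDiffusion (fun X => (S X : ℂ)) C 0)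
    (hadd : LoopEq.IsStrictlyAdditive 𝒟 S)
    (κ : ℝ) (hκ : 0 < κ)
    (W : LoopEq.LoopFamily) (hW : LoopEq.SatisfiesHierarchy N lam ρ 𝒟 W) :
    LoopEq.SatisfiesHierarchy N lam ρ 𝒟 (LoopEq.dress κ S W) := by
  intro m C hC i I hself hcontact
  set E : ℂ := ((Real.exp (-κ * ∑ k, S (C k)) : ℝ) : ℂ) with hE
  have hE0 : E ≠ 0 := Complex.ofReal_ne_zero.2 (Real.exp_ne_zero _)
  -- The given integrals `I j` belong to the dressed contact terms, so the undressed ones have the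
  -- values `E⁻¹ * I j`.
  have hdiff := hW m C hC i (fun j => E⁻¹ * I j)
    (hself.const_mul (inv_ne_zero hE0) fun s t h hk => by
      rw [LoopEq.splitTerm_dress N κ W C i s t h (hadd.1 _ (hC i) s t h hk), ← hE,
        inv_mul_cancel_left₀ hE0])
    (fun j hj => (hcontact j hj).const_mul (inv_ne_zero hE0) fun s t h => by
      rw [LoopEq.mergeTerm_dress N κ W C hj s t h (hadd.2 _ (hC i) _ (hC j) s t h), ← hE,
        inv_mul_cancel_left₀ hE0])
  -- With the other loops frozen, the weight is an entire function of `S` of the `i`-th loop; the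
  -- chain rule then gives `𝓛_i` of it as a multiple of zero.
  have hexp := (hzero (C i) (hC i)).comp
    (f := fun z => Complex.exp (-κ * (((∑ k, S (C k) - S (C i) : ℝ) : ℂ) + z)))
    (by fun_prop)
  have hweight : ∀ X, Complex.exp (-κ * (((∑ k, S (C k) - S (C i) : ℝ) : ℂ) + S X)) =
      ((Real.exp (-κ * ∑ k, S (Function.update C i X k)) : ℝ) : ℂ) := by
    intro X
    rw [LoopEq.sum_update]
    push_cast
    rfl
  convert hdiff.mul hexp using 1
  · funext X
    rw [hweight]
    rfl
  · rw [hweight, Function.update_eq_self, ← hE, ← Finset.mul_sum, mul_inv_cancel_left₀ hE0]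
    ring
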